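/- **Theorem 1.5 (Spherical Orchard Theorem).** Let $d\ge 1$ and let $\mathcal P=\{\pm P_1,\dots,\pm P_n\}\subset \mathbf S^d\subset\mathbf R^{d+1}$ be an antipodal set of $n$ pairs of points (so $|\mathcal P|=2n$) which is generic: any $k\le d+1$ of the pairs span a linear subspace of dimension $k$. (Binomial coefficients $\binom mk$ with $m<0$ are read as $\binom 0k$.) For a finite set $\mathcal A$ of $n$ points of a $d$-dimensional real affine space and $p,q\in\mathcal A$, let $n(p,q)$ be the number of distinct hyperplanes that are affinely spanned by $d$ distinct points of $\mathcal A\setminus\{p,q\}$ and separate $p$ from $q$; write $p\approx q$ if $p=q$ or $n(p,q)\equiv\binom{n-3}{d-1}\pmod 2$. For a unit vector $v$ whose equator $v^\perp\cap\mathbf S^d$ contains no point of $\mathcal P$, let $\pi_v(x)=x/\langle v,x\rangle$ be the central projection to the affine hyperplane $\{z:\langle v,z\rangle=1\}\cong\mathbf R^d$, and let $\approx$ be the above relation for the $n$-point set $\pi_v(\mathcal P)$. Define a relation $\sim_v$ on $\mathcal P$ as follows. If $\binom{n-2}d$ is even, then $x\sim_v y$ if and only if $\pi_v(x)\approx\pi_v(y)$.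 If $\binom{n-2}d$ is odd, then, for $x,y$ in the same open hemisphere bounded by the equator, $x\sim_v y$ if and only if $\pi_v(x)\approx\pi_v(y)$, and, for $x,y$ in opposite open hemispheres, $x\sim_v y$ if and only if $\pi_v(x)\not\approx\pi_v(y)$. Then such $v$ exist, and $\sim_v$ does not depend on the choice of $v$. The resulting relation $\sim$ is natural: for every linear automorphism $A$ of $\mathbf R^{d+1}$ and all $x,y\in\mathcal P$, one has $x\sim y$ in $\mathcal P$ if and only if $Ax/\|Ax\|\sim Ay/\|Ay\|$ in the configuration $\{Az/\|Az\|: z\in\mathcal P\}$. Moreover $\sim$ is an equivalence relation on $\mathcal P$ with at most two classes. If $\binom{n-2}{d}$ is even, then $-P_i\sim P_i$ for all $i$; if $\binom{n-2}{d}$ is odd, then $-P_i\not\sim P_i$ for all $i$. -/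

import Mathlib

open scoped RealInnerProductSpace

/-- The ambient space `ℝ^(d+1)` of the unit sphere `S^d`. -/
abbrev Ambient (d : ℕ) : Type := EuclideanSpace ℝ (Fin (d + 1))

/-- `P = {±P_1, …, ±P_n}` is a generic antipodal configuration of `n` pairs of points on the unit
sphere `S^d ⊂ ℝ^(d+1)`: any `k ≤ d + 1` antipodal pairs of `P` span a linear subspace of
dimension `k`. -/
structure IsGenericAntipodal (d n : ℕ) (P : Set (Ambient d)) : Prop where
  subset_sphere : P ⊆ Metric.sphere 0 1
  neg_mem : ∀ x ∈ P, -x ∈ P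
  finite : P.Finite
  ncard_eq : P.ncard = 2 * n
  finrank_span : ∀ k ≤ d + 1, ∀ S ⊆ P, (∀ x ∈ S, -x ∈ S) → S.ncard = 2 * k →
    Module.finrank ℝ (Submodule.span ℝ S) = k

section Affine

variable {V : Type*} [AddCommGroup V] [Module ℝ V]

/-- The number `n(p, q)` of distinct hyperplanes of the `d`-dimensional real affine space `V` that
are affinely spanned by `d` distinct points of `𝒜 ∖ {p, q}` and that separate `p` from `q`. -/
noncomputable def separatingCount (d : ℕ) (𝒜 : Set V) (p q : V) : ℕ :=
  Set.ncard {H : AffineSubspace ℝ V |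
    (∃ S : Finset V, (S : Set V) ⊆ 𝒜 \ {p, q} ∧ S.card = d ∧ H = affineSpan ℝ (S : Set V)) ∧
      H.SOppSide p q}

/-- The (affine) Orchard relation of a configuration `𝒜` in the `d`-dimensional real affine
space `V`. -/
def OrchardRel (d : ℕ) (𝒜 : Set V) (p q : V) : Prop :=
  p = q ∨ separatingCount d 𝒜 p q ≡ (𝒜.ncard - 3).choose (d - 1) [MOD 2]

end Affine

/-- The unit vector `v` is a pole of an equatorial sphere `{x ∈ S^d | ⟪v, x⟫ = 0}` that avoids
all points of `P`. -/
def IsAvoidingPole {d : ℕ} (P : Set (Ambient d)) (v : Ambient d) : Prop :=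
  ‖v‖ = 1 ∧ ∀ x ∈ P, ⟪v, x⟫ ≠ 0

/-- Central projection from the origin onto the affine hyperplane `{z | ⟪v, z⟫ = 1}`
(`x ↦ x / ⟪v, x⟫`), which is tangent to the sphere at the unit vector `v` and which we identify
with the `d`-dimensional space `v^⊥` by `z ↦ z - v`, that is, by the orthogonal projection. It
identifies the open hemisphere around `v` with `v^⊥`, sends the equator with pole `v` to infinity,
and takes the same value at `x` and `-x`. -/
noncomputable def centralProj {d : ℕ} (v x : Ambient d) : (ℝ ∙ v)ᗮ :=
  (ℝ ∙ v)ᗮ.orthogonalProjectionOnto (⟪v, x⟫⁻¹ • x)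

/-- The relation on `P = {±P_1, …, ±P_n}` constructed with the equator of pole `v`. Representatives
of two pairs in the same open hemisphere are compared by the affine Orchard relation of
`{π P_1, …, π P_n}`, where `π` is the central projection. If `(n-2 choose d)` is even, this relation
on pairs is pulled back to `P`. If it is odd, the relation on the hemisphere is extended to `P` with
two classes by putting `x` and `-x` in different classes. -/
def SphericalOrchardRelAt (d n : ℕ) (P : Set (Ambient d)) (v x y : Ambient d) : Prop :=
  (Even ((n - 2).choose d) ∧
    OrchardRel d (centralProj v '' P) (centralProj v x) (centralProj v y)) ∨
  (Odd ((n - 2).choose d) ∧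
    (0 < ⟪v, x⟫ * ⟪v, y⟫ ↔
      OrchardRel d (centralProj v '' P) (centralProj v x) (centralProj v y)))

/-- The spherical Orchard relation: the relation constructed with some equator avoiding `P`. -/
def SphericalOrchardRel (d n : ℕ) (P : Set (Ambient d)) (x y : Ambient d) : Prop :=
  ∃ v, IsAvoidingPole P v ∧ SphericalOrchardRelAt d n P v x y

/-- The map induced on the unit sphere by a linear automorphism of `ℝ^(d+1)`. -/
noncomputable def sphereMap {d : ℕ} (A : Ambient d ≃ₗ[ℝ] Ambient d) (x : Ambient d) : Ambient d :=
  ‖A x‖⁻¹ • A x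

/-! Choose one vector e_i from each antipodal pair. For i ≠ j let σ(i,j), modulo 2, count the d-sets
of other indices whose linear hyperplane separates e_i from e_j. In a chart, the affine hyperplanes
counted by the Orchard relation correspond to such d-sets, with e_i replaced by e_i/⟪v, e_i⟫
(`separatingCount_centralProj`). Changing the sign of one vector toggles all C = (n-2 choose d)
hyperplanes, so it changes σ by C (`separationParity_smul_smul`). The clause for odd C cancels this
effect: for i ≠ j, the points s e_i and t e_j are related iff σ(i,j) + (n-3 choose d-1) + [st < 0] C
= 0, where v no longer occurs.

Transitivity rests on σ(i,j) + σ(i,k) + σ(j,k) = (n-3 choose d-1) (`separationParity_cocycle`). A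
d-set avoiding i, j, k separates 0 or 2 of the three pairs. For d-1 fixed further indices, adjoining
i, j or k in turn yields an odd number of separations of the remaining pair
(`separates_insert_parity`). Hence the shifted parity `pairParity` is additive, and together with
the sign term it gives a two-colouring. Linear automorphisms preserve separation, whence naturality.
-/

/-! ### Separation by linear hyperplanes in general position -/

section GeneralPosition

variable {ι V : Type*} [AddCommGroup V] [Module ℝ V]

/-- Any `d + 1` of the vectors `e i` are linearly independent. -/
def InGeneralPosition (d : ℕ) (e : ι → V) : Prop :=
  ∀ T : Finset ι, T.card ≤ d + 1 → LinearIndepOn ℝ e (T : Set ι)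

/-- Some linear hyperplane containing all `e t`, `t ∈ T`, strictly separates `x` from `y`. -/
def Separates (e : ι → V) (T : Finset ι) (x y : V) : Prop :=
  ∃ φ : Module.Dual ℝ V, (∀ t ∈ T, φ (e t) = 0) ∧ φ x * φ y < 0

theorem Separates.symm {e : ι → V} {T : Finset ι} {x y : V} (h : Separates e T x y) :
    Separates e T y x := by
  obtain ⟨φ, h0, h⟩ := h
  exact ⟨φ, h0, by rwa [mul_comm]⟩

theorem separates_comm {e : ι → V} {T : Finset ι} {x y : V} :
    Separates e T x y ↔ Separates e T y x :=
  ⟨Separates.symm, Separates.symm⟩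

theorem separates_comp_linearEquiv (A : V ≃ₗ[ℝ] V) (e : ι → V) (T : Finset ι) (x y : V) :
    Separates (A ∘ e) T (A x) (A y) ↔ Separates e T x y := by
  constructor
  · rintro ⟨φ, h0, h⟩
    exact ⟨φ ∘ₗ A.toLinearMap, by simpa using h0, by simpa using h⟩
  · rintro ⟨φ, h0, h⟩
    exact ⟨φ ∘ₗ A.symm.toLinearMap, by simpa using h0, by simpa using h⟩

namespace InGeneralPosition

variable {d : ℕ} {e : ι → V}

theorem comp_linearEquiv (he : InGeneralPosition d e) (A : V ≃ₗ[ℝ] V) :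
    InGeneralPosition d (A ∘ e) := fun T hT =>
  LinearIndependent.map' (he T hT) A.toLinearMap A.ker

theorem exists_dual [DecidableEq ι] (he : InGeneralPosition d e) {T : Finset ι} (hT : T.card ≤ d)
    {i : ι} (hi : i ∉ T) :
    ∃ φ : Module.Dual ℝ V, (∀ t ∈ T, φ (e t) = 0) ∧ φ (e i) = 1 := by
  have h := he (insert i T) (by rw [Finset.card_insert_of_notMem hi]; omega)
  rw [Finset.coe_insert] at h
  obtain ⟨f, hf, hT⟩ := Submodule.exists_le_ker_of_notMem (h.notMem_span_of_insert (by simpa using hi))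
  refine ⟨(f (e i))⁻¹ • f, fun t ht => ?_, by simp [hf]⟩
  have : f (e t) = 0 := hT (Submodule.subset_span ⟨t, ht, rfl⟩)
  simp [this]

variable [FiniteDimensional ℝ V]

theorem span_eq_top (he : InGeneralPosition d e) (hV : Module.finrank ℝ V = d + 1) {T : Finset ι}
    (hT : T.card = d + 1) : Submodule.span ℝ (e '' (T : Set ι)) = ⊤ := by
  have h := he T hT.le
  have := LinearIndependent.span_eq_top_of_card_eq_finrank' h (by simp [hT, hV])
  rwa [← Set.image_eq_range] at this

/-- The `d + 1` vectors involved span the space. Consequently a form vanishing on `T` is unique up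
to scaling. -/
theorem eq_zero [DecidableEq ι] (he : InGeneralPosition d e) (hV : Module.finrank ℝ V = d + 1)
    {T : Finset ι} (hT : T.card = d) {i : ι} (hi : i ∉ T) {φ : Module.Dual ℝ V}
    (h0 : ∀ t ∈ T, φ (e t) = 0) (hφi : φ (e i) = 0) : φ = 0 := by
  refine LinearMap.ext_on (he.span_eq_top hV (T := insert i T) ?_) ?_
  · rw [Finset.card_insert_of_notMem hi, hT]
  · rintro _ ⟨t, ht, rfl⟩
    rcases Finset.mem_insert.1 (Finset.mem_coe.1 ht) with rfl | ht
    · simpa using hφi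
    · simpa using h0 t ht

/-- Two equations of the hyperplane differ by a factor c, which multiplies the product of values by
c². So any nonzero equation decides separation. -/
theorem separates_iff [DecidableEq ι] (he : InGeneralPosition d e)
    (hV : Module.finrank ℝ V = d + 1) {T : Finset ι} (hT : T.card = d) {i : ι} (hi : i ∉ T)
    {φ : Module.Dual ℝ V} (h0 : ∀ t ∈ T, φ (e t) = 0) (hφ : φ ≠ 0) (x y : V) :
    Separates e T x y ↔ φ x * φ y < 0 := by
  refine ⟨?_, fun h => ⟨φ, h0, h⟩⟩
  rintro ⟨ψ, hψ0, hψ⟩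
  have hi' : φ (e i) ≠ 0 := fun h => hφ (he.eq_zero hV hT hi h0 h)
  have key : φ (e i) • ψ - ψ (e i) • φ = 0 := by
    refine he.eq_zero hV hT hi (fun t ht => ?_) ?_
    · simp [h0 t ht, hψ0 t ht]
    · simp [mul_comm]
  have hz : ∀ z, ψ z = ψ (e i) / φ (e i) * φ z := fun z => by
    have := LinearMap.congr_fun key z
    simp only [LinearMap.sub_apply, LinearMap.smul_apply, smul_eq_mul, LinearMap.zero_apply] at this
    field_simp
    linarith
  rw [hz x, hz y] at hψ
  by_contra h
  push Not at h
  nlinarith [mul_nonneg (sq_nonneg (ψ (e i) / φ (e i))) h]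

/-- Changing the sign of one of two vectors changes the separation by a hyperplane. -/
theorem separates_smul_smul [DecidableEq ι] (he : InGeneralPosition d e)
    (hV : Module.finrank ℝ V = d + 1) {T : Finset ι} (hT : T.card = d) {i j : ι} (hi : i ∉ T)
    (hj : j ∉ T) {s t : ℝ} (hs : s ≠ 0) (ht : t ≠ 0) :
    Separates e T (s • e i) (t • e j) ↔ (Separates e T (e i) (e j) ↔ 0 < s * t) := by
  obtain ⟨φ, h0, h1⟩ := he.exists_dual hT.le hi
  have hφ : φ ≠ 0 := by rintro rfl; simp at h1
  have hφj : φ (e j) ≠ 0 := fun h => hφ (he.eq_zero hV hT hj h0 h)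
  rw [he.separates_iff hV hT hi h0 hφ, he.separates_iff hV hT hi h0 hφ]
  simp only [map_smul, smul_eq_mul, h1, one_mul, mul_one]
  rcases hs.lt_or_gt with hs | hs <;> rcases ht.lt_or_gt with ht | ht <;>
    rcases hφj.lt_or_gt with hj | hj <;>
    simp [mul_neg_iff, mul_pos_iff, hs, ht, hj, hs.not_gt, ht.not_gt, hj.not_gt]

end InGeneralPosition

/-- Of the three hyperplanes spanned by `T` and one of three further points, an odd number
separates the other two points. -/
theorem separates_insert_parity [FiniteDimensional ℝ V] [DecidableEq ι] {d : ℕ} {e : ι → V} (he : InGeneralPosition (d + 1) e)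
    (hV : Module.finrank ℝ V = d + 2) {T : Finset ι} (hT : T.card = d) {i j k : ι}
    (hij : i ≠ j) (hik : i ≠ k) (hjk : j ≠ k) (hi : i ∉ T) (hj : j ∉ T) (hk : k ∉ T) :
    (Separates e (insert i T) (e j) (e k) ↔ Separates e (insert j T) (e i) (e k)) ↔
      Separates e (insert k T) (e i) (e j) := by
  have hci : (insert i T).card = d + 1 := by rw [Finset.card_insert_of_notMem hi, hT]
  have hcj : (insert j T).card = d + 1 := by rw [Finset.card_insert_of_notMem hj, hT]
  have hck : (insert k T).card = d + 1 := by rw [Finset.card_insert_of_notMem hk, hT]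
  have hji : j ∉ insert i T := by simp [hij.symm, hj]
  have hki : k ∉ insert i T := by simp [hik.symm, hk]
  have hkj : k ∉ insert j T := by simp [hjk.symm, hk]
  have hij' : i ∉ insert j T := by simp [hij, hi]
  have hik' : i ∉ insert k T := by simp [hik, hi]
  obtain ⟨α, hα0, hα⟩ := he.exists_dual hci.le hji
  obtain ⟨β, hβ0, hβ⟩ := he.exists_dual hcj.le hij'
  have hα' : α ≠ 0 := by rintro rfl; simp at hα
  have hβ' : β ≠ 0 := by rintro rfl; simp at hβ
  have hαi := hα0 i (Finset.mem_insert_self ..)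
  have hβj := hβ0 j (Finset.mem_insert_self ..)
  have hαk : α (e k) ≠ 0 := fun h => hα' (he.eq_zero hV hci hki hα0 h)
  have hβk : β (e k) ≠ 0 := fun h => hβ' (he.eq_zero hV hcj hkj hβ0 h)
  -- This combination is the equation of the third hyperplane. The three products of values are `α
  -- (e k)`, `β (e k)` and `-α (e k) * β (e k)`; their product is negative, so an odd number of them
  -- is negative.
  have hγ0 : ∀ t ∈ insert k T, (β (e k) • α - α (e k) • β) (e t) = 0 := by
    intro t ht
    rcases Finset.mem_insert.1 ht with rfl | ht
    · simp [mul_comm]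
    · simp [hα0 t (Finset.mem_insert_of_mem ht), hβ0 t (Finset.mem_insert_of_mem ht)]
  have hγ : β (e k) • α - α (e k) • β ≠ 0 := fun h => hβk <| by
    simpa [hα, hβj] using LinearMap.congr_fun h (e j)
  rw [he.separates_iff hV hci hji hα0 hα', he.separates_iff hV hcj hij' hβ0 hβ',
    he.separates_iff hV hck hik' hγ0 hγ]
  simp only [LinearMap.sub_apply, LinearMap.smul_apply, smul_eq_mul, hα, hβ, hαi, hβj]
  rcases hαk.lt_or_gt with h1 | h1 <;> rcases hβk.lt_or_gt with h2 | h2 <;>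
    simp [h1, h2, h1.not_gt, h2.not_gt, mul_pos_iff]

end GeneralPosition

/-! ### Parity of the number of separating hyperplanes -/

section Parity

variable {ι V : Type*} [AddCommGroup V] [Module ℝ V] [Fintype ι] [DecidableEq ι]

open Classical in
/-- The parity of the number of `d`-element sets of indices different from `i` and `j` whose
vectors span a linear hyperplane separating `x` from `y`. -/
noncomputable def separationParity (d : ℕ) (e : ι → V) (i j : ι) (x y : V) : ZMod 2 :=
  ∑ T ∈ ({i, j}ᶜ : Finset ι).powersetCard d, if Separates e T x y then 1 else 0

theorem separationParity_symm (d : ℕ) (e : ι → V) (i j : ι) (x y : V) :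
    separationParity d e i j x y = separationParity d e j i y x := by
  classical
  simp only [separationParity, Finset.pair_comm i j]
  exact Finset.sum_congr rfl fun T _ => by rw [separates_comm]

theorem card_powersetCard_compl_pair (d : ℕ) {i j : ι} (hij : i ≠ j) :
    (({i, j}ᶜ : Finset ι).powersetCard d).card = (Fintype.card ι - 2).choose d := by
  rw [Finset.card_powersetCard, Finset.card_compl, Finset.card_pair hij]

/-- Splitting by whether `k` belongs to the set lets the parities of the three pairs in a triple be
summed over common index sets. -/
theorem separationParity_eq_sum_insert {m : ℕ} {e : ι → V} {i j k : ι} (hik : i ≠ k) (hjk : j ≠ k)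
    (x y : V) [∀ T, Decidable (Separates e T x y)] :
    separationParity (m + 1) e i j x y =
      ∑ T ∈ ({i, j, k}ᶜ : Finset ι).powersetCard (m + 1), (if Separates e T x y then 1 else 0) +
      ∑ T ∈ ({i, j, k}ᶜ : Finset ι).powersetCard m,
        if Separates e (insert k T) x y then 1 else 0 := by
  have hk : k ∉ ({i, j, k}ᶜ : Finset ι) := by simp
  have h : ({i, j}ᶜ : Finset ι) = insert k ({i, j, k}ᶜ : Finset ι) := by
    ext t
    simp only [Finset.mem_compl, Finset.mem_insert, Finset.mem_singleton]
    by_cases t = k <;> grind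
  rw [separationParity, h, Finset.powersetCard_succ_insert hk, Finset.sum_union, Finset.sum_image]
  · congr!
  · intro T hT T' hT' hTT
    have h1 : k ∉ T := fun h => hk ((Finset.mem_powersetCard.1 hT).1 h)
    have h2 : k ∉ T' := fun h => hk ((Finset.mem_powersetCard.1 hT').1 h)
    rw [← Finset.erase_insert h1, ← Finset.erase_insert h2]
    exact congrArg (Finset.erase · k) hTT
  · rw [Finset.disjoint_left]
    intro T hT hT'
    obtain ⟨T', -, rfl⟩ := Finset.mem_image.1 hT'
    exact hk ((Finset.mem_powersetCard.1 hT).1 (Finset.mem_insert_self ..))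

variable {d : ℕ} {e : ι → V} [FiniteDimensional ℝ V]

theorem separationParity_smul_smul (he : InGeneralPosition d e)
    (hV : Module.finrank ℝ V = d + 1) {i j : ι} (hij : i ≠ j) {s t : ℝ} (hs : s ≠ 0)
    (ht : t ≠ 0) :
    separationParity d e i j (s • e i) (t • e j) = separationParity d e i j (e i) (e j) +
      if 0 < s * t then 0 else ((Fintype.card ι - 2).choose d : ZMod 2) := by
  classical
  have key : ∀ T ∈ ({i, j}ᶜ : Finset ι).powersetCard d,
      (if Separates e T (s • e i) (t • e j) then (1 : ZMod 2) else 0) =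
      (if Separates e T (e i) (e j) then 1 else 0) + if 0 < s * t then 0 else 1 := by
    intro T hT
    rw [Finset.mem_powersetCard] at hT
    have hi : i ∉ T := fun h => by simpa using hT.1 h
    have hj : j ∉ T := fun h => by simpa using hT.1 h
    have := he.separates_smul_smul hV hT.2 hi hj hs ht
    by_cases h1 : Separates e T (e i) (e j) <;> by_cases h2 : 0 < s * t <;>
      simp only [this, h1, h2] <;> decide
  rw [separationParity, Finset.sum_congr rfl key, Finset.sum_add_distrib, Finset.sum_const,
    card_powersetCard_compl_pair d hij, separationParity]
  split_ifs <;> simp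

theorem separationParity_cocycle (he : InGeneralPosition d e) (hd : 1 ≤ d)
    (hV : Module.finrank ℝ V = d + 1) {i j k : ι} (hij : i ≠ j) (hik : i ≠ k) (hjk : j ≠ k) :
    separationParity d e i j (e i) (e j) + separationParity d e i k (e i) (e k) +
      separationParity d e j k (e j) (e k) = ((Fintype.card ι - 3).choose (d - 1) : ZMod 2) := by
  classical
  obtain ⟨m, rfl⟩ : ∃ m, d = m + 1 := ⟨d - 1, by omega⟩
  have hc : (({i, j, k}ᶜ : Finset ι).powersetCard m).card = (Fintype.card ι - 3).choose m := by
    rw [Finset.card_powersetCard, Finset.card_compl, Finset.card_eq_three.2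
      ⟨i, j, k, hij, hik, hjk, rfl⟩]
  have h1 : ({i, k, j} : Finset ι) = {i, j, k} := by rw [Finset.pair_comm]
  have h2 : ({j, k, i} : Finset ι) = {i, j, k} := by ext; simp; tauto
  rw [separationParity_eq_sum_insert hik hjk, separationParity_eq_sum_insert hij hjk.symm,
    separationParity_eq_sum_insert hij.symm hik.symm, h1, h2, Nat.add_sub_cancel, ← hc,
    Finset.card_eq_sum_ones, Nat.cast_sum]
  -- Unprimed terms come from sets avoiding i, j, k; primed ones from sets containing exactly one of
  -- them.
  have e1 : ∀ a b c a' b' c' : ZMod 2, a + a' + (b + b') + (c + c') = a + b + c + (a' + b' + c') := by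
    intros; ring
  rw [e1]
  simp only [← Finset.sum_add_distrib]
  rw [Finset.sum_eq_zero, zero_add]
  · refine Finset.sum_congr rfl fun T hT => ?_
    rw [Finset.mem_powersetCard] at hT
    have hi : i ∉ T := fun h => by simpa using hT.1 h
    have hj : j ∉ T := fun h => by simpa using hT.1 h
    have hk : k ∉ T := fun h => by simpa using hT.1 h
    have := separates_insert_parity he hV hT.2 hij hik hjk hi hj hk
    rw [← this]
    by_cases a : Separates e (insert i T) (e j) (e k) <;>
      by_cases b : Separates e (insert j T) (e i) (e k) <;> simp only [a, b] <;> decide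
  -- The form is nonzero at all three vectors, so two of the signs agree and 0 or 2 pairs are
  -- separated.
  · intro T hT
    rw [Finset.mem_powersetCard] at hT
    have hi : i ∉ T := fun h => by simpa using hT.1 h
    have hj : j ∉ T := fun h => by simpa using hT.1 h
    have hk : k ∉ T := fun h => by simpa using hT.1 h
    obtain ⟨φ, h0, h1⟩ := he.exists_dual hT.2.le hi
    have hφ : φ ≠ 0 := by rintro rfl; simp at h1
    have hφj : φ (e j) ≠ 0 := fun h => hφ (he.eq_zero hV hT.2 hj h0 h)
    have hφk : φ (e k) ≠ 0 := fun h => hφ (he.eq_zero hV hT.2 hk h0 h)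
    simp only [he.separates_iff hV hT.2 hi h0 hφ, h1, one_mul, mul_neg_iff]
    rcases hφj.lt_or_gt with h1 | h1 <;> rcases hφk.lt_or_gt with h2 | h2 <;>
      simp only [h1, h2, h1.not_gt, h2.not_gt] <;> decide

end Parity

/-! ### Equations of affine and linear hyperplanes -/

/-- Points on opposite sides of an affine hyperplane, in terms of an equation of the hyperplane. -/
theorem AffineSubspace.sOppSide_iff_mul_neg {W : Type*} [AddCommGroup W] [Module ℝ W]
    {H : AffineSubspace ℝ W} {f : W →ᵃ[ℝ] ℝ} (hf : ∀ w, w ∈ H ↔ f w = 0) (p q : W) :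
    H.SOppSide p q ↔ f p * f q < 0 := by
  constructor
  · rintro ⟨hw, hp, hq⟩
    obtain ⟨r, hr, t, ⟨ht0, ht1⟩, rfl⟩ := AffineSubspace.wOppSide_iff_exists_wbtw.1 hw
    rw [hf, AffineMap.apply_lineMap, AffineMap.lineMap_apply_module] at hr
    rw [hf] at hp hq
    simp only [smul_eq_mul] at hr
    by_contra h
    have hpos : 0 < f p * f q := lt_of_le_of_ne (not_lt.1 h) (mul_ne_zero hp hq).symm
    have h1 : (1 - t) * (f p * f p) + t * (f p * f q) = 0 := by linear_combination f p * hr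
    have h2 : 0 < f p * f p := mul_self_pos.2 hp
    rcases ht0.eq_or_lt with rfl | ht0
    · linarith
    · nlinarith [mul_pos ht0 hpos, mul_nonneg (sub_nonneg.2 ht1) h2.le]
  · intro h
    have hp : f p ≠ 0 := fun h0 => by simp [h0] at h
    have hq : f q ≠ 0 := fun h0 => by simp [h0] at h
    -- The parameter is the zero of `f` on the line from `p` to `q`.
    refine ⟨AffineSubspace.wOppSide_iff_exists_wbtw.2
      ⟨AffineMap.lineMap p q (f p / (f p - f q)), ?_, ⟨_, ?_, rfl⟩⟩, by rwa [hf], by rwa [hf]⟩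
    · have : f p - f q ≠ 0 := fun h0 => by
        rw [sub_eq_zero.1 h0] at h
        exact h.not_ge (mul_self_nonneg _)
      rw [hf, AffineMap.apply_lineMap, AffineMap.lineMap_apply_module]
      simp only [smul_eq_mul]
      field_simp
      ring
    · rcases hp.lt_or_gt with hp | hp
      · have hq : 0 < f q := by nlinarith
        exact ⟨div_nonneg_of_nonpos (by linarith) (by linarith),
          (div_le_one_of_neg (by linarith)).2 (by linarith)⟩
      · have hq : f q < 0 := by nlinarith
        exact ⟨div_nonneg (by linarith) (by linarith),
          (div_le_one (by linarith)).2 (by linarith)⟩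

theorem InGeneralPosition.mem_span_of_apply_eq_zero {ι V : Type*} [AddCommGroup V] [Module ℝ V]
    [FiniteDimensional ℝ V] [DecidableEq ι] {d : ℕ} {e : ι → V} (he : InGeneralPosition d e)
    (hV : Module.finrank ℝ V = d + 1) {T : Finset ι} (hT : T.card = d) {i : ι} (hi : i ∉ T)
    {φ : Module.Dual ℝ V} (h0 : ∀ t ∈ T, φ (e t) = 0) (hφ : φ ≠ 0) {x : V} (hx : φ x = 0) :
    x ∈ Submodule.span ℝ (e '' (T : Set ι)) := by
  have htop := he.span_eq_top hV (T := insert i T) (by rw [Finset.card_insert_of_notMem hi, hT])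
  rw [Finset.coe_insert, Set.image_insert_eq] at htop
  obtain ⟨a, z, hz, rfl⟩ := Submodule.mem_span_insert.1 (htop ▸ Submodule.mem_top (x := x))
  have hφz : φ z = 0 := by
    have : Submodule.span ℝ (e '' (T : Set ι)) ≤ LinearMap.ker φ := by
      rw [Submodule.span_le]
      rintro _ ⟨t, ht, rfl⟩
      exact h0 t ht
    exact this hz
  have hi' : φ (e i) ≠ 0 := fun h => hφ (he.eq_zero hV hT hi h0 h)
  have : a = 0 := by simpa [hφz, hi'] using hx
  simpa [this] using hz

/-! ### Central projection and affine hyperplanes -/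

section CentralProjection

variable {d : ℕ} {v : Ambient d}

theorem finrank_ambient (d : ℕ) : Module.finrank ℝ (Ambient d) = d + 1 := by simp

theorem coe_centralProj (hv : ‖v‖ = 1) {x : Ambient d} (hx : ⟪v, x⟫ ≠ 0) :
    (centralProj v x : Ambient d) = ⟪v, x⟫⁻¹ • x - v := by
  rw [centralProj, ← Submodule.starProjection_apply, Submodule.starProjection_orthogonal']
  simp [Submodule.starProjection_unit_singleton ℝ hv, smul_sub, smul_smul, hx]

theorem centralProj_smul (v x : Ambient d) {s : ℝ} (hs : s ≠ 0) :
    centralProj v (s • x) = centralProj v x := by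
  rw [centralProj, centralProj, inner_smul_right, smul_smul, mul_inv, mul_right_comm,
    inv_mul_cancel₀ hs, one_mul]

/-- The restriction of a linear form to the affine hyperplane through `v` orthogonal to `v`. -/
noncomputable def tangentForm (v : Ambient d) (φ : Module.Dual ℝ (Ambient d)) :
    (ℝ ∙ v)ᗮ →ᵃ[ℝ] ℝ where
  toFun w := φ (v + w)
  linear := φ ∘ₗ (ℝ ∙ v)ᗮ.subtype
  map_vadd' p w := by simp; ring

theorem tangentForm_apply (v : Ambient d) (φ : Module.Dual ℝ (Ambient d)) (w : (ℝ ∙ v)ᗮ) :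
    tangentForm v φ w = φ (v + w) := rfl

theorem tangentForm_centralProj (hv : ‖v‖ = 1) (φ : Module.Dual ℝ (Ambient d)) {x : Ambient d}
    (hx : ⟪v, x⟫ ≠ 0) : tangentForm v φ (centralProj v x) = φ (⟪v, x⟫⁻¹ • x) := by
  rw [tangentForm_apply, coe_centralProj hv hx, add_sub_cancel]

variable {ι : Type*} {e : ι → Ambient d}

theorem centralProj_injective (hd : 1 ≤ d) (he : InGeneralPosition d e) (hv : ‖v‖ = 1)
    (hve : ∀ i, ⟪v, e i⟫ ≠ 0) : Function.Injective fun i => centralProj v (e i) := by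
  classical
  intro i j hij
  by_contra hne
  -- Here `d ≥ 1` makes the two vectors independent; a form killing `e j` but not `e i` tells their
  -- images apart.
  obtain ⟨φ, h0, h1⟩ := he.exists_dual (T := {j}) (by simpa using hd) (i := i) (by simpa using hne)
  have := congrArg (tangentForm v φ) hij
  rw [tangentForm_centralProj hv φ (hve i), tangentForm_centralProj hv φ (hve j)] at this
  simp [h1, h0 j (by simp), hve i] at this

theorem mem_affineSpan_centralProj_iff [DecidableEq ι] (he : InGeneralPosition d e)
    (hv : ‖v‖ = 1) (hve : ∀ i, ⟪v, e i⟫ ≠ 0) {T : Finset ι} (hT : T.card = d) {i : ι} (hi : i ∉ T)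
    {φ : Module.Dual ℝ (Ambient d)} (h0 : ∀ t ∈ T, φ (e t) = 0) (hφ : φ ≠ 0) (w : (ℝ ∙ v)ᗮ) :
    w ∈ affineSpan ℝ ((fun i => centralProj v (e i)) '' (T : Set ι)) ↔ tangentForm v φ w = 0 := by
  constructor
  · intro hw
    refine affineSpan_induction (p := fun w => tangentForm v φ w = 0) hw ?_ ?_
    · rintro _ ⟨t, ht, rfl⟩
      rw [tangentForm_centralProj hv φ (hve t), map_smul, h0 t ht, smul_zero]
    · intro c a b z ha hb hz
      rw [AffineMap.map_vadd, map_smul, AffineMap.linearMap_vsub, ha, hb, hz]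
      simp
  · intro hw
    rw [tangentForm_apply] at hw
    obtain ⟨c, hc⟩ := (Submodule.mem_span_image_finset_iff_exists_fun ℝ).1
      (he.mem_span_of_apply_eq_zero (finrank_ambient d) hT hi h0 hφ hw)
    have hvw : ⟪v, (w : Ambient d)⟫ = 0 := Submodule.mem_orthogonal_singleton_iff_inner_right.1 w.2
    -- Pairing `∑ c t • e t = v + w` with `v` gives total weight 1, and `w` is the affine
    -- combination of the projected points with these weights.
    have hsum : ∑ t : T, c t * ⟪v, e t⟫ = 1 := by
      have := congrArg (fun x => ⟪v, x⟫) hc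
      simpa [inner_sum, inner_smul_right, inner_add_right, hvw, hv] using this
    have hmem := affineCombination_mem_affineSpan hsum fun t : T => centralProj v (e t)
    rw [Finset.affineCombination_eq_linear_combination _ _ _ hsum] at hmem
    have hw' : ∑ t : T, (c t * ⟪v, e t⟫) • centralProj v (e t) = w := by
      ext1
      rw [Submodule.coe_sum]
      simp only [Submodule.coe_smul, coe_centralProj hv (hve _), smul_sub, Finset.sum_sub_distrib,
        smul_smul, mul_assoc, mul_inv_cancel₀ (hve _), mul_one, hc, ← Finset.sum_smul, hsum]
      simp
    rw [hw'] at hmem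
    convert hmem using 2
    ext x
    simp

open Classical in
/-- The separating hyperplanes of the projected configuration correspond to sets of indices. -/
theorem separatingCount_centralProj [Fintype ι] [DecidableEq ι] (hd : 1 ≤ d)
    (he : InGeneralPosition d e) (hv : ‖v‖ = 1) (hve : ∀ i, ⟪v, e i⟫ ≠ 0) (i j : ι) :
    separatingCount d (Set.range fun i => centralProj v (e i)) (centralProj v (e i))
      (centralProj v (e j)) = ((({i, j}ᶜ : Finset ι).powersetCard d).filter fun T =>
        Separates e T (⟪v, e i⟫⁻¹ • e i) (⟪v, e j⟫⁻¹ • e j)).card := by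
  have hinj := centralProj_injective hd he hv hve
  have hV := finrank_ambient d
  have hform : ∀ T : Finset ι, T.card = d → i ∉ T → ∃ φ : Module.Dual ℝ (Ambient d),
      φ ≠ 0 ∧ (∀ t ∈ T, φ (e t) = 0) ∧
      ∀ w, w ∈ affineSpan ℝ ((fun i => centralProj v (e i)) '' (T : Set ι)) ↔
        tangentForm v φ w = 0 := by
    intro T hT hi
    obtain ⟨φ, h0, h1⟩ := he.exists_dual hT.le hi
    have hφ : φ ≠ 0 := by rintro rfl; simp at h1
    exact ⟨φ, hφ, h0, mem_affineSpan_centralProj_iff he hv hve hT hi h0 hφ⟩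
  have hside : ∀ T : Finset ι, T.card = d → i ∉ T →
      ((affineSpan ℝ ((fun i => centralProj v (e i)) '' (T : Set ι))).SOppSide
        (centralProj v (e i)) (centralProj v (e j)) ↔
        Separates e T (⟪v, e i⟫⁻¹ • e i) (⟪v, e j⟫⁻¹ • e j)) := by
    intro T hT hi
    obtain ⟨φ, hφ, h0, hmem⟩ := hform T hT hi
    rw [AffineSubspace.sOppSide_iff_mul_neg hmem, he.separates_iff hV hT hi h0 hφ,
      tangentForm_centralProj hv φ (hve i), tangentForm_centralProj hv φ (hve j)]
  rw [separatingCount, ← Set.ncard_coe_finset]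
  symm
  refine Set.ncard_congr
    (fun T _ => affineSpan ℝ ((fun i => centralProj v (e i)) '' (T : Set ι))) ?_ ?_ ?_
  · intro T hT
    simp only [Finset.coe_filter, Finset.mem_powersetCard, Set.mem_ofPred_eq] at hT
    obtain ⟨⟨hsub, hT⟩, hsep⟩ := hT
    refine ⟨⟨T.image fun i => centralProj v (e i), ?_, ?_, by rw [Finset.coe_image]⟩,
      (hside T hT fun h => by simpa using hsub h).2 hsep⟩
    · rw [Finset.coe_image]
      rintro _ ⟨t, ht, rfl⟩
      have := hsub ht
      simp only [Finset.mem_compl, Finset.mem_insert, Finset.mem_singleton, not_or] at this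
      exact ⟨⟨t, rfl⟩, by simpa [hinj.eq_iff] using this⟩
    · rw [Finset.card_image_of_injective _ hinj, hT]
  -- If `T'` spans the same hyperplane, the equation for `T` vanishes on `T'`; an index of `T'`
  -- outside `T` would force it to be zero.
  · intro T T' hT hT' heq
    simp only [Finset.coe_filter, Finset.mem_powersetCard, Set.mem_ofPred_eq] at hT hT'
    obtain ⟨φ, hφ, h0, hmem⟩ := hform T hT.1.2 fun h => by simpa using hT.1.1 h
    symm
    refine Finset.eq_of_subset_of_card_le (fun t ht => ?_) (hT.1.2.trans hT'.1.2.symm).le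
    by_contra htT
    have h1 := subset_affineSpan ℝ _ (Set.mem_image_of_mem (fun i => centralProj v (e i))
      (Finset.mem_coe.2 ht))
    rw [← heq, SetLike.mem_coe, hmem, tangentForm_centralProj hv φ (hve t)] at h1
    exact hφ (he.eq_zero hV hT.1.2 htT h0 (by simpa [hve t] using h1))
  · rintro H ⟨⟨S, hS, hcard, rfl⟩, hopp⟩
    have hSr : (S : Set (ℝ ∙ v)ᗮ) ⊆ Set.range fun i => centralProj v (e i) := fun x hx => (hS hx).1
    obtain ⟨T, rfl⟩ : ∃ T : Finset ι, T.image (fun i => centralProj v (e i)) = S :=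
      ⟨Finset.univ.filter fun i => centralProj v (e i) ∈ S, by
        ext x
        simp only [Finset.mem_image, Finset.mem_filter, Finset.mem_univ, true_and]
        refine ⟨?_, fun hx => ?_⟩
        · rintro ⟨a, ha, rfl⟩
          exact ha
        · obtain ⟨a, rfl⟩ := hSr (Finset.mem_coe.2 hx)
          exact ⟨a, hx, rfl⟩⟩
    rw [Finset.card_image_of_injective _ hinj] at hcard
    rw [Finset.coe_image] at hopp hS ⊢
    have hsub : T ⊆ {i, j}ᶜ := fun t ht => by
      have := (hS (Set.mem_image_of_mem _ (Finset.mem_coe.2 ht))).2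
      simpa [hinj.eq_iff] using this
    refine ⟨T, ?_, rfl⟩
    simp only [Finset.coe_filter, Finset.mem_powersetCard, Set.mem_ofPred_eq]
    exact ⟨⟨hsub, hcard⟩, (hside T hcard fun h => by simpa using hsub h).1 hopp⟩

end CentralProjection

/-! ### The additive parity on pairs of indices -/

section PairParity

variable {ι V : Type*} [AddCommGroup V] [Module ℝ V] [Fintype ι] [DecidableEq ι]

/-- The Orchard relation on the indices of a configuration, as a function vanishing on related
pairs. -/
noncomputable def pairParity (d : ℕ) (e : ι → V) (i j : ι) : ZMod 2 :=
  if i = j then 0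
  else separationParity d e i j (e i) (e j) + ((Fintype.card ι - 3).choose (d - 1) : ZMod 2)

theorem pairParity_comp_linearEquiv (A : V ≃ₗ[ℝ] V) (d : ℕ) (e : ι → V) (i j : ι) :
    pairParity d (A ∘ e) i j = pairParity d e i j := by
  simp only [pairParity, separationParity, Function.comp_apply]
  congr! 4
  exact separates_comp_linearEquiv A e _ _ _

theorem pairParity_self (d : ℕ) (e : ι → V) (i : ι) : pairParity d e i i = 0 := if_pos rfl

/-- For distinct indices, the added binomial coefficient is exactly the sum around the triangle, so
it cancels the defect of additivity modulo 2. -/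
theorem pairParity_add [FiniteDimensional ℝ V] {d : ℕ} {e : ι → V} (he : InGeneralPosition d e)
    (hd : 1 ≤ d) (hV : Module.finrank ℝ V = d + 1) (i j k : ι) :
    pairParity d e i j + pairParity d e i k = pairParity d e j k := by
  by_cases hij : i = j
  · subst hij
    rw [pairParity_self, zero_add]
  by_cases hik : i = k
  · subst hik
    rw [pairParity_self, add_zero, pairParity, pairParity, if_neg hij, if_neg (Ne.symm hij),
      separationParity_symm]
  by_cases hjk : j = k
  · subst hjk
    rw [pairParity_self, CharTwo.add_self_eq_zero]
  have h := separationParity_cocycle he hd hV hij hik hjk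
  rw [pairParity, pairParity, pairParity, if_neg hij, if_neg hik, if_neg hjk, ← h]
  generalize separationParity d e i j (e i) (e j) = a
  generalize separationParity d e i k (e i) (e k) = b
  generalize separationParity d e j k (e j) (e k) = c
  revert a b c
  decide

end PairParity

/-! ### The relation in terms of representatives -/

/-- `P` consists of nonzero multiples of the vectors `e i`, all of which occur up to scaling. -/
structure Represents {ι : Type*} {d : ℕ} (e : ι → Ambient d) (P : Set (Ambient d)) : Prop where
  exists_smul_mem : ∀ i, ∃ s : ℝ, s ≠ 0 ∧ s • e i ∈ P
  exists_eq_smul : ∀ x ∈ P, ∃ i, ∃ s : ℝ, s ≠ 0 ∧ x = s • e i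

namespace Represents

variable {ι : Type*} {d : ℕ} {e : ι → Ambient d} {P : Set (Ambient d)} {v : Ambient d}

theorem inner_ne_zero (h : Represents e P) (hv : IsAvoidingPole P v) (i : ι) : ⟪v, e i⟫ ≠ 0 := by
  obtain ⟨s, -, hs⟩ := h.exists_smul_mem i
  intro h0
  exact hv.2 _ hs (by rw [inner_smul_right, h0, mul_zero])

theorem image_centralProj (h : Represents e P) :
    centralProj v '' P = Set.range fun i => centralProj v (e i) := by
  ext w
  constructor
  · rintro ⟨x, hx, rfl⟩
    obtain ⟨i, s, hs, rfl⟩ := h.exists_eq_smul x hx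
    exact ⟨i, (centralProj_smul v _ hs).symm⟩
  · rintro ⟨i, rfl⟩
    obtain ⟨s, hs, hsP⟩ := h.exists_smul_mem i
    exact ⟨_, hsP, centralProj_smul v _ hs⟩

/-- Positivity of `c` is what matters: normalisation preserves the signs on which the relation
depends. -/
theorem sphereMap_smul (A : Ambient d ≃ₗ[ℝ] Ambient d) {s : ℝ} (hs : s ≠ 0) {x : Ambient d}
    (hx : x ≠ 0) : ∃ c : ℝ, 0 < c ∧ sphereMap A (s • x) = (c * s) • A x := by
  refine ⟨‖A (s • x)‖⁻¹, inv_pos.2 (norm_pos_iff.2 ?_), by rw [sphereMap, map_smul, smul_smul]⟩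
  simpa using ⟨hs, hx⟩

theorem sphereMap_image (h : Represents e P) (he : ∀ i, e i ≠ 0) (A : Ambient d ≃ₗ[ℝ] Ambient d) :
    Represents (A ∘ e) (sphereMap A '' P) := by
  constructor
  · intro i
    obtain ⟨s, hs, hsP⟩ := h.exists_smul_mem i
    obtain ⟨c, hc, h⟩ := sphereMap_smul A hs (he i)
    exact ⟨c * s, mul_ne_zero hc.ne' hs, _, hsP, h⟩
  · rintro _ ⟨x, hx, rfl⟩
    obtain ⟨i, s, hs, rfl⟩ := h.exists_eq_smul x hx
    obtain ⟨c, hc, h⟩ := sphereMap_smul A hs (he i)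
    exact ⟨i, c * s, mul_ne_zero hc.ne' hs, h⟩

variable [Fintype ι] [DecidableEq ι]

/-- The affine Orchard relation in the chart of an equator, in terms of `pairParity`. -/
theorem orchardRel_iff (h : Represents e P) (hd : 1 ≤ d) (he : InGeneralPosition d e)
    (hv : IsAvoidingPole P v) (i j : ι) :
    OrchardRel d (centralProj v '' P) (centralProj v (e i)) (centralProj v (e j)) ↔
      pairParity d e i j + (if 0 < ⟪v, e i⟫ * ⟪v, e j⟫ then 0
        else ((Fintype.card ι - 2).choose d : ZMod 2)) = 0 := by
  classical
  have hve := h.inner_ne_zero hv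
  have hinj := centralProj_injective hd he hv.1 hve
  rw [OrchardRel, h.image_centralProj, hinj.eq_iff]
  by_cases hij : i = j
  · subst hij
    simp [pairParity_self, mul_self_pos.2 (hve i)]
  have hcard : (Set.range fun i => centralProj v (e i)).ncard = Fintype.card ι := by
    rw [← Set.image_univ, Set.ncard_image_of_injective _ hinj, Set.ncard_univ, Nat.card_eq_fintype_card]
  have hpos : 0 < ⟪v, e i⟫⁻¹ * ⟪v, e j⟫⁻¹ ↔ 0 < ⟪v, e i⟫ * ⟪v, e j⟫ := by
    rw [← mul_inv, inv_pos]
  rw [separatingCount_centralProj hd he hv.1 hve, hcard, or_iff_right hij,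
    ← ZMod.natCast_eq_natCast_iff, Finset.card_filter, Nat.cast_sum]
  have hs : ∑ T ∈ ({i, j}ᶜ : Finset ι).powersetCard d, (((if Separates e T (⟪v, e i⟫⁻¹ • e i)
      (⟪v, e j⟫⁻¹ • e j) then 1 else 0 : ℕ)) : ZMod 2) =
      separationParity d e i j (⟪v, e i⟫⁻¹ • e i) (⟪v, e j⟫⁻¹ • e j) := by
    rw [separationParity]
    push_cast
    congr!
  rw [hs, separationParity_smul_smul he (finrank_ambient d) hij (inv_ne_zero (hve i))
    (inv_ne_zero (hve j)), pairParity, if_neg hij, ← CharTwo.add_eq_zero]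
  simp only [hpos]
  rw [add_right_comm]

/-- The spherical Orchard relation in the chart of an equator, in terms of data independent of the
equator. -/
theorem sphericalOrchardRelAt_iff (h : Represents e P) (hd : 1 ≤ d) (he : InGeneralPosition d e)
    (hv : IsAvoidingPole P v) (i j : ι) {s t : ℝ} (hs : s ≠ 0) (ht : t ≠ 0) :
    SphericalOrchardRelAt d (Fintype.card ι) P v (s • e i) (t • e j) ↔
      pairParity d e i j + (if 0 < s * t then 0
        else ((Fintype.card ι - 2).choose d : ZMod 2)) = 0 := by
  have hi := h.inner_ne_zero hv i
  have hj := h.inner_ne_zero hv j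
  rw [SphericalOrchardRelAt, centralProj_smul v _ hs, centralProj_smul v _ ht,
    h.orchardRel_iff hd he hv, inner_smul_right, inner_smul_right, mul_mul_mul_comm]
  have hZ : ∀ a : ZMod 2, (a + 1 = 0 ↔ ¬ a = 0) := by decide
  rcases Nat.even_or_odd ((Fintype.card ι - 2).choose d) with hC | hC
  · have hC0 : ((Fintype.card ι - 2).choose d : ZMod 2) = 0 := (ZMod.natCast_eq_zero_iff_even).2 hC
    simp [hC, hC0, Nat.not_odd_iff_even.2 hC]
  · have hC1 : ((Fintype.card ι - 2).choose d : ZMod 2) = 1 := (ZMod.natCast_eq_one_iff_odd).2 hC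
    simp only [hC, hC1, Nat.not_even_iff_odd.2 hC, false_and, true_and, false_or]
    -- The sign of `⟪v, e i⟫ * ⟪v, e j⟫` enters twice, through the hemispheres and through the
    -- chart, and cancels; only the sign of `s * t` remains.
    rcases (mul_ne_zero hs ht).lt_or_gt with h1 | h1 <;>
      rcases (mul_ne_zero hi hj).lt_or_gt with h2 | h2 <;>
      simp [h1, h2, h1.not_gt, h2.not_gt, mul_pos_iff, hZ]

theorem sphericalOrchardRel_iff (h : Represents e P) (hd : 1 ≤ d) (he : InGeneralPosition d e)
    (hP : ∃ v, IsAvoidingPole P v) (i j : ι) {s t : ℝ} (hs : s ≠ 0) (ht : t ≠ 0) :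
    SphericalOrchardRel d (Fintype.card ι) P (s • e i) (t • e j) ↔
      pairParity d e i j + (if 0 < s * t then 0
        else ((Fintype.card ι - 2).choose d : ZMod 2)) = 0 := by
  refine ⟨fun ⟨v, hv, hr⟩ => (h.sphericalOrchardRelAt_iff hd he hv i j hs ht).1 hr, fun hr => ?_⟩
  obtain ⟨v, hv⟩ := hP
  exact ⟨v, hv, (h.sphericalOrchardRelAt_iff hd he hv i j hs ht).2 hr⟩

/-- The spherical Orchard relation is given by a colouring with two colours. -/
theorem exists_coloring (h : Represents e P) (hd : 1 ≤ d) (he : InGeneralPosition d e)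
    (hP : ∃ v, IsAvoidingPole P v) :
    ∃ c : P → ZMod 2, ∀ x y : P, c x = c y ↔ SphericalOrchardRel d (Fintype.card ι) P x y := by
  choose i s hs hx using fun x : P => h.exists_eq_smul x x.2
  by_cases hι : IsEmpty P
  · exact ⟨0, fun x => hι.elim x⟩
  obtain ⟨x₀⟩ := not_isEmpty_iff.1 hι
  -- Additivity writes `pairParity` of two indices as the sum of their values from the base index,
  -- and equal sign terms cancel modulo 2.
  refine ⟨fun x => pairParity d e (i x₀) (i x) +
    if 0 < s x then 0 else ((Fintype.card ι - 2).choose d : ZMod 2), fun x y => ?_⟩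
  have hxy := h.sphericalOrchardRel_iff hd he hP (i x) (i y) (hs x) (hs y)
  rw [← hx x, ← hx y] at hxy
  beta_reduce
  rw [hxy, ← pairParity_add he hd (finrank_ambient d) (i x₀) (i x) (i y), ← CharTwo.add_eq_zero]
  generalize ((Fintype.card ι - 2).choose d : ZMod 2) = C
  generalize pairParity d e (i x₀) (i x) = a
  generalize pairParity d e (i x₀) (i y) = b
  rcases (hs x).lt_or_gt with h1 | h1 <;> rcases (hs y).lt_or_gt with h2 | h2 <;>
    simp only [h1, h2, h1.not_gt, h2.not_gt, mul_pos_iff, and_false, and_true, false_or, or_false,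
      if_true, if_false, and_self] <;> revert a b C <;> decide

end Represents

/-! ### Existence of poles and of representatives -/

theorem exists_isAvoidingPole {d : ℕ} {P : Set (Ambient d)} (hfin : P.Finite)
    (hP : ∀ x ∈ P, x ≠ 0) : ∃ v, IsAvoidingPole P v := by
  have := hfin.to_subtype
  -- The extra vector at `none` keeps `f` nonzero, hence normalisable, even when `P` is empty.
  obtain ⟨f, hf⟩ := Module.exists_dual_forall_apply_ne_zero (K := ℝ)
    (fun o : Option P => o.elim (EuclideanSpace.single 0 1 : Ambient d) (↑)) (by
      rintro (_ | x)
      · simp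
      · exact hP x x.2)
  set w := (InnerProductSpace.toDual ℝ (Ambient d)).symm (LinearMap.toContinuousLinearMap f) with hw
  have hin : ∀ x, ⟪w, x⟫ = f x := fun x => by simp [hw]
  have hw0 : w ≠ 0 := fun h0 => hf none (by rw [← hin, h0, inner_zero_left])
  refine ⟨‖w‖⁻¹ • w, by simp [norm_smul, hw0], fun x hx => ?_⟩
  rw [real_inner_smul_left, hin]
  exact mul_ne_zero (inv_ne_zero (norm_ne_zero_iff.2 hw0)) (hf (some ⟨x, hx⟩))

/-- The representatives are the points of `P` in the open hemisphere around `v`. -/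
theorem IsGenericAntipodal.exists_represents {d n : ℕ} {P : Set (Ambient d)}
    (hP : IsGenericAntipodal d n P) {v : Ambient d} (hv : IsAvoidingPole P v) :
    ∃ e : Fin n → Ambient d, Represents e P ∧ InGeneralPosition d e := by
  classical
  set Q := hP.finite.toFinset.filter fun x => 0 < ⟪v, x⟫ with hQ
  have hmem : ∀ x, x ∈ Q ↔ x ∈ P ∧ 0 < ⟪v, x⟫ := by simp [hQ]
  have hdisj : ∀ S ⊆ Q, Disjoint S (S.image Neg.neg) := fun S hS => by
    rw [Finset.disjoint_left]
    intro x hx hx'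
    obtain ⟨y, hy, rfl⟩ := Finset.mem_image.1 hx'
    have h1 := ((hmem _).1 (hS hx)).2
    rw [inner_neg_right] at h1
    linarith [((hmem _).1 (hS hy)).2]
  have hdouble : ∀ S ⊆ Q, ((S ∪ S.image Neg.neg : Finset (Ambient d)) : Set (Ambient d)).ncard =
      2 * S.card := fun S hS => by
    rw [Set.ncard_coe_finset, Finset.card_union_of_disjoint (hdisj S hS),
      Finset.card_image_of_injective _ neg_injective, two_mul]
  have hPQ : ((Q ∪ Q.image Neg.neg : Finset (Ambient d)) : Set (Ambient d)) = P := by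
    ext x
    simp only [Finset.coe_union, Finset.coe_image, Set.mem_union, Finset.mem_coe, Set.mem_image, hmem]
    constructor
    · rintro (h | ⟨y, h, rfl⟩)
      exacts [h.1, hP.neg_mem _ h.1]
    · intro hx
      rcases (hv.2 x hx).lt_or_gt with h | h
      · exact Or.inr ⟨-x, ⟨hP.neg_mem _ hx, by rw [inner_neg_right]; linarith⟩, neg_neg x⟩
      · exact Or.inl ⟨hx, h⟩
  have hcard : Q.card = n := by
    have := hdouble Q subset_rfl
    rw [hPQ, hP.ncard_eq] at this
    omega
  let f := (Q.equivFinOfCardEq hcard).symm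
  refine ⟨fun i => f i, ⟨fun i => ⟨1, one_ne_zero, ?_⟩, fun x hx => ?_⟩, fun T hT => ?_⟩
  · rw [one_smul]
    exact ((hmem _).1 (f i).2).1
  · rw [← hPQ, Finset.mem_coe, Finset.mem_union, Finset.mem_image] at hx
    rcases hx with hx | ⟨y, hy, rfl⟩
    · exact ⟨f.symm ⟨x, hx⟩, 1, one_ne_zero, by simp⟩
    · exact ⟨f.symm ⟨y, hy⟩, -1, by simp, by simp⟩
  · have hinj : Function.Injective fun i => (f i : Ambient d) :=
      Subtype.val_injective.comp f.injective
    set S := T.image fun i => (f i : Ambient d) with hS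
    have hSQ : S ⊆ Q := fun x hx => by
      obtain ⟨i, -, rfl⟩ := Finset.mem_image.1 hx
      exact (f i).2
    have hST : S.card = T.card := Finset.card_image_of_injective _ hinj
    -- Genericity concerns symmetric sets, so it is applied to `S ∪ -S`, which has the same span as
    -- `S`.
    have hrank := hP.finrank_span T.card hT ((S ∪ S.image Neg.neg : Finset (Ambient d)) : Set _)
      (by
        rw [← hPQ]
        exact Finset.coe_subset.2 (Finset.union_subset_union hSQ (Finset.image_subset_image hSQ)))
      (by
        intro x hx
        rw [Finset.mem_coe, Finset.mem_union] at hx ⊢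
        simp only [Finset.mem_image] at hx ⊢
        rcases hx with hx | ⟨y, hy, rfl⟩
        · exact Or.inr ⟨x, hx, rfl⟩
        · exact Or.inl (by rwa [neg_neg]))
      (by rw [hdouble S hSQ, hST])
    have hspan : Submodule.span ℝ ((S ∪ S.image Neg.neg : Finset (Ambient d)) : Set (Ambient d)) =
        Submodule.span ℝ (S : Set (Ambient d)) := by
      refine le_antisymm (Submodule.span_le.2 fun x hx => ?_)
        (Submodule.span_mono (Finset.coe_subset.2 Finset.subset_union_left))
      rw [Finset.mem_coe, Finset.mem_union] at hx
      simp only [Finset.mem_image] at hx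
      rcases hx with hx | ⟨y, hy, rfl⟩
      · exact Submodule.subset_span hx
      · exact Submodule.neg_mem _ (Submodule.subset_span hy)
    rw [hspan] at hrank
    refine linearIndependent_iff_card_eq_finrank_span.2 ?_
    have hrange : Set.range (fun i : (T : Set (Fin n)) => (f i : Ambient d)) = S := by
      rw [hS, Finset.coe_image, Set.image_eq_range]
    rw [Set.finrank, hrange, hrank]
    simp

theorem Setoid.encard_classes_ker_le {α β : Type*} [Fintype β] (f : α → β) :
    (Setoid.ker f).classes.encard ≤ Fintype.card β := by
  refine (Set.encard_le_encard (Setoid.classes_ker_subset_fiber_set f)).trans ?_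
  rw [← Set.image_univ]
  refine (Set.encard_image_le _ _).trans ?_
  simp

/-! ### The spherical Orchard theorem -/

theorem theorem1p5 (d n : ℕ) (hd : 1 ≤ d) (P : Set (Ambient d)) (hP : IsGenericAntipodal d n P) :
    -- the construction is possible, and does not depend on the choice of the equator
    (∃ v, IsAvoidingPole P v) ∧
    (∀ v, IsAvoidingPole P v → ∀ x ∈ P, ∀ y ∈ P,
      (SphericalOrchardRel d n P x y ↔ SphericalOrchardRelAt d n P v x y)) ∧
    -- it is compatible with the action of the linear group on the sphere
    (∀ A : Ambient d ≃ₗ[ℝ] Ambient d, ∀ x ∈ P, ∀ y ∈ P,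
      (SphericalOrchardRel d n (sphereMap A '' P) (sphereMap A x) (sphereMap A y) ↔
        SphericalOrchardRel d n P x y)) ∧
    -- it is an equivalence relation on the configuration with at most two classes
    (∃ r : Setoid P, (∀ x y : P, r x y ↔ SphericalOrchardRel d n P x y) ∧
      r.classes.encard ≤ 2) ∧
    -- it relates antipodal points according to the parity of the binomial coefficient
    (Even ((n - 2).choose d) → ∀ x ∈ P, SphericalOrchardRel d n P (-x) x) ∧
    (Odd ((n - 2).choose d) → ∀ x ∈ P, ¬ SphericalOrchardRel d n P (-x) x) := by
  have hP0 : ∀ x ∈ P, x ≠ 0 := fun x hx => ne_zero_of_mem_unit_sphere ⟨x, hP.subset_sphere hx⟩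
  have hpole := exists_isAvoidingPole hP.finite hP0
  obtain ⟨v₀, hv₀⟩ := id hpole
  -- The pole `v₀` only selects representatives; the formulas below hold for every avoiding pole.
  obtain ⟨e, hrep, he⟩ := hP.exists_represents hv₀
  have he0 : ∀ i, e i ≠ 0 := fun i h0 => hrep.inner_ne_zero hv₀ i (by rw [h0, inner_zero_right])
  have hat := fun v (hv : IsAvoidingPole P v) i j (s t : ℝ) (hs : s ≠ 0) (ht : t ≠ 0) =>
    hrep.sphericalOrchardRelAt_iff hd he hv i j hs ht
  have hrel := fun i j (s t : ℝ) (hs : s ≠ 0) (ht : t ≠ 0) =>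
    hrep.sphericalOrchardRel_iff hd he hpole i j hs ht
  have hcol := hrep.exists_coloring hd he hpole
  simp only [Fintype.card_fin] at hat hrel hcol
  refine ⟨hpole, ?_, ?_, ?_, ?_, ?_⟩
  · intro v hv x hx y hy
    obtain ⟨i, s, hs, rfl⟩ := hrep.exists_eq_smul x hx
    obtain ⟨j, t, ht, rfl⟩ := hrep.exists_eq_smul y hy
    rw [hat v hv i j s t hs ht, hrel i j s t hs ht]
  · intro A x hx y hy
    obtain ⟨i, s, hs, rfl⟩ := hrep.exists_eq_smul x hx
    obtain ⟨j, t, ht, rfl⟩ := hrep.exists_eq_smul y hy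
    obtain ⟨a, ha, hxa⟩ := Represents.sphereMap_smul A hs (he0 i)
    obtain ⟨b, hb, hyb⟩ := Represents.sphereMap_smul A ht (he0 j)
    have hpole' : ∃ v, IsAvoidingPole (sphereMap A '' P) v := by
      refine exists_isAvoidingPole (hP.finite.image _) ?_
      rintro _ ⟨z, hz, rfl⟩
      simpa [sphereMap] using hP0 z hz
    have := (hrep.sphereMap_image he0 A).sphericalOrchardRel_iff hd (he.comp_linearEquiv A) hpole'
      i j (mul_ne_zero ha.ne' hs) (mul_ne_zero hb.ne' ht)
    have hpos : 0 < a * s * (b * t) ↔ 0 < s * t := by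
      rw [mul_mul_mul_comm, mul_pos_iff_of_pos_left (mul_pos ha hb)]
    simp only [Fintype.card_fin, pairParity_comp_linearEquiv, hpos, Function.comp_apply] at this
    rw [hxa, hyb, this, hrel i j s t hs ht]
  · obtain ⟨c, hc⟩ := hcol
    exact ⟨Setoid.ker c, hc, by simpa using Setoid.encard_classes_ker_le c⟩
  · intro hC x hx
    obtain ⟨i, s, hs, rfl⟩ := hrep.exists_eq_smul x hx
    rw [← neg_smul, hrel i i (-s) s (neg_ne_zero.2 hs) hs, pairParity_self,
      ZMod.natCast_eq_zero_iff_even.2 hC, ite_self, add_zero]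
  · intro hC x hx
    obtain ⟨i, s, hs, rfl⟩ := hrep.exists_eq_smul x hx
    have hneg : ¬ 0 < -s * s := by nlinarith [mul_self_nonneg s]
    rw [← neg_smul, hrel i i (-s) s (neg_ne_zero.2 hs) hs, pairParity_self, if_neg hneg,
      ZMod.natCast_eq_one_iff_odd.2 hC, zero_add]
    exact one_ne_zero
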